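/- Let $K \subset \mathbb{C}$ be a compact set with connected complement $\mathbb{C} \setminus K$ and without interior points, and let $f : K \to \mathbb{C}$ be a continuous function. Then for every $\varepsilon > 0$ there exists a polynomial $p$ with complex coefficients such that $p(z) \neq 0$ for all $z \in K$ and $$|p(z) - f(z)| < \varepsilon \qquad \text{for all } z \in K.$$ -/

import Mathlib

open Metric Filter Topology MeasureTheory

/-! The proof combines Lavrentiev's theorem (`polyClosure_eq_top`) with a perturbation of roots: `K`
has empty interior, so each linear factor of an approximating polynomial can have its root moved
slightly off `K` (`Polynomial.exists_near_of_nonvanishing`).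

By Stone–Weierstrass, Lavrentiev's theorem reduces to approximating `conj z` on `K`. For a disc
containing `K`, the integral of `1 / (z - ζ)` over `ζ` in the disc equals `π * conj z`. It therefore
suffices to replace the Cauchy kernel by polynomials in `z` with small integrated error. If `p` is a
polynomial with `p c = 1` and `ζ` is near `c`, then `(1 - p z / p ζ) / (z - ζ)` is a polynomial in
`z`, with error `p z / (p ζ * (z - ζ))`. If `p` is bounded and decays like `r / |z - c|` on `K`,
this error is `O(√r * |z - ζ| ^ (-3/2))`, which is integrable in the plane.

Such peaks come from `(1 - g) / (1 + g)` with `g ^ 2 = (z - a) / (z - b)`, where `a, b ∉ K` lie near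
`c` at scale `r`. Connectedness of the complement provides the branch `g`, and characters of the
closed algebra justify the division. -/

theorem Subalgebra.exists_mem_eq_comp {X : Type*} [TopologicalSpace X] [CompactSpace X]
    {S : Subalgebra ℂ C(X, ℂ)} (hS : IsClosed (S : Set C(X, ℂ))) {t : C(X, ℂ)} (ht : t ∈ S)
    {h : ℂ → ℂ} {R : ℝ} (hh : DifferentiableOn ℂ h (closedBall 0 R)) (htR : ‖t‖ < R) :
    ∃ u ∈ S, ∀ x, u x = h (t x) := by
  have hR : 0 < R := (norm_nonneg t).trans_lt htR
  lift R to NNReal using hR.le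
  -- The range of `t` lies in the disc of radius `r' < R`, where the Taylor sums of `h` converge
  -- uniformly; evaluated at `t` they are polynomials in `t`.
  obtain ⟨r', h1, h2⟩ := exists_between htR
  lift r' to NNReal using (norm_nonneg t).trans h1.le
  have hp := hh.hasFPowerSeriesOnBall (by exact_mod_cast hR)
  set P := cauchyPowerSeries h 0 R
  have hu := hp.tendstoUniformlyOn (r' := r') (by exact_mod_cast h2)
  have hmem : ∀ x, ‖t x‖ < r' := fun x => (t.norm_coe_le_norm x).trans_lt h1
  have hcont : Continuous fun x => h (t x) :=
    hh.continuousOn.comp_continuous t.continuous fun x => by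
      simpa using ((hmem x).trans h2).le
  refine ⟨⟨_, hcont⟩, ?_, fun x => rfl⟩
  have hmemS : ∀ n, (∑ k ∈ Finset.range n, P.coeff k • t ^ k) ∈ S := fun n =>
    S.sum_mem fun k _ => S.smul_mem (S.pow_mem ht k) _
  refine hS.mem_of_tendsto (b := atTop) (f := fun n : ℕ => ∑ k ∈ Finset.range n, P.coeff k • t ^ k) ?_
    (Eventually.of_forall hmemS)
  rw [ContinuousMap.tendsto_iff_tendstoUniformly, Metric.tendstoUniformly_iff]
  rw [Metric.tendstoUniformlyOn_iff] at hu
  intro ε hε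
  filter_upwards [hu ε hε] with n hn x
  have := hn (t x) (by simpa using hmem x)
  simpa [FormalMultilinearSeries.partialSum, FormalMultilinearSeries.apply_eq_pow_smul_coeff,
    mul_comm] using this

/-- The uniform closure on `K` of the polynomial functions. -/
noncomputable abbrev polyClosure (K : Set ℂ) [CompactSpace K] : Subalgebra ℂ C(K, ℂ) :=
  (polynomialFunctions K).topologicalClosure

/-! ### Pole pushing and inversion in the polynomial closure -/

section

variable {K : Set ℂ} [CompactSpace K]

theorem isClosed_polyClosure : IsClosed (polyClosure K : Set C(K, ℂ)) :=
  Subalgebra.isClosed_topologicalClosure _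

theorem toContinuousMapOn_mem_polyClosure (p : Polynomial ℂ) :
    p.toContinuousMapOn K ∈ polyClosure K :=
  Subalgebra.le_topologicalClosure _ ⟨p, by simp⟩

theorem exists_polynomial_of_mem_polyClosure {u : C(K, ℂ)} (hu : u ∈ polyClosure K) {ε : ℝ}
    (hε : 0 < ε) : ∃ p : Polynomial ℂ, ∀ z : K, ‖p.eval (z : ℂ) - u z‖ < ε := by
  obtain ⟨v, hv, huv⟩ := Metric.mem_closure_iff.1 hu ε hε
  obtain ⟨p, -, rfl⟩ := hv
  refine ⟨p, fun z => ?_⟩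
  have := (ContinuousMap.dist_apply_le_dist (f := u) (g := _) z).trans_lt huv
  rw [dist_comm, dist_eq_norm] at this
  simpa using this

/-- The coordinate function on `K`. -/
noncomputable abbrev coordMap (K : Set ℂ) : C(K, ℂ) := ⟨fun z => (z : ℂ), continuous_subtype_val⟩

theorem coordMap_mem : coordMap K ∈ polyClosure K := by
  convert toContinuousMapOn_mem_polyClosure (K := K) Polynomial.X
  ext z; simp

theorem norm_le_half_of_eq_div_sub {b c : ℂ} {δ : ℝ} (hδ : 0 < δ) (hb : ∀ z ∈ K, δ ≤ ‖z - b‖) {t : C(K, ℂ)}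
    (ht : ∀ z : K, t z = c / (z - b)) (hc : ‖c‖ ≤ δ / 2) : ‖t‖ ≤ 1 / 2 := by
  rw [ContinuousMap.norm_le _ (by norm_num)]
  intro z
  have h1 := hb z z.2
  rw [ht, norm_div, div_le_iff₀ (hδ.trans_le h1)]
  linarith

theorem exists_polyClosure_inv_sub_of_far {b : ℂ} (hb : ‖coordMap K‖ < ‖b‖) :
    ∃ u ∈ polyClosure K, ∀ z : K, u z = (z - b)⁻¹ := by
  obtain ⟨R, h1, h2⟩ := exists_between hb
  refine Subalgebra.exists_mem_eq_comp (h := fun w => (w - b)⁻¹) isClosed_polyClosure coordMap_mem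
    (DifferentiableOn.inv (by fun_prop) ?_) h1
  intro w hw h0
  rw [sub_eq_zero.1 h0] at hw
  simp at hw
  linarith

/-- A pole can be moved by at most half of its distance to `K`. -/
theorem exists_polyClosure_inv_sub_of_near {b b' : ℂ} {δ : ℝ} (hδ : 0 < δ)
    (hb : ∀ z ∈ K, δ ≤ ‖z - b‖) (hbb : ‖b' - b‖ ≤ δ / 2)
    (h : ∃ u ∈ polyClosure K, ∀ z : K, u z = (z - b)⁻¹) :
    ∃ u ∈ polyClosure K, ∀ z : K, u z = (z - b')⁻¹ := by
  obtain ⟨u, hu, hu'⟩ := h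
  have ht := (polyClosure K).smul_mem hu (b' - b)
  have htn : ‖(b' - b) • u‖ ≤ 1 / 2 :=
    norm_le_half_of_eq_div_sub hδ hb (fun z => by simp [hu', div_eq_mul_inv]) hbb
  -- With `t = (b' - b) / (z - b)`, one has `1 / (z - b') = 1 / (z - b) * 1 / (1 - t)`. Any radius
  -- strictly between `1 / 2` and `1` would do.
  obtain ⟨v, hv, hv'⟩ := Subalgebra.exists_mem_eq_comp (h := fun w => (1 - w)⁻¹) (R := 3 / 4)
    isClosed_polyClosure ht (DifferentiableOn.inv (by fun_prop) (by
      intro w hw h0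
      rw [← sub_eq_zero.1 h0] at hw
      norm_num at hw)) (htn.trans_lt (by norm_num))
  refine ⟨u * v, (polyClosure K).mul_mem hu hv, fun z => ?_⟩
  have hz : (z : ℂ) - b ≠ 0 := by
    intro h0
    have := hb z z.2
    rw [h0, norm_zero] at this
    linarith
  simp only [ContinuousMap.mul_apply, hv', hu', ContinuousMap.smul_apply, smul_eq_mul]
  rw [← mul_inv]
  congr 1
  field_simp
  ring

theorem exists_forall_le_norm_sub {b : ℂ} (hb : b ∉ K) : ∃ δ > 0, ∀ z ∈ K, δ ≤ ‖z - b‖ := by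
  have hK : IsClosed K := (isCompact_iff_compactSpace.2 ‹_›).isClosed
  obtain ⟨δ, hδ, h⟩ := Metric.isOpen_iff.1 hK.isOpen_compl b hb
  refine ⟨δ, hδ, fun z hz => ?_⟩
  by_contra! hlt
  exact h (by simpa [dist_eq_norm] using hlt) hz

/-- A property of points off `K` that is inherited in both directions along steps that are short
compared with the distance to `K` holds at all points off `K` once it holds at one. -/
theorem compl_subset_of_step (hKc : IsConnected Kᶜ) {P : ℂ → Prop} (hP : ∀ b, P b → b ∉ K)
    (hne : ∃ a, P a)
    (hfwd : ∀ b, P b → ∀ δ > 0, (∀ z ∈ K, δ ≤ ‖z - b‖) → ∃ ρ > 0, ∀ b', ‖b' - b‖ < ρ → P b')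
    (hbwd : ∀ b ∉ K, b ∈ closure {x | P x} → ∀ δ > 0, (∀ z ∈ K, δ ≤ ‖z - b‖) →
      ∃ ρ > 0, ∀ b', ‖b' - b‖ < ρ → P b' → P b) : ∀ b ∉ K, P b := by
  refine hKc.isPreconnected.subset_of_closure_inter_subset (u := {x | P x}) ?_ ?_ ?_
  · refine Metric.isOpen_iff.2 fun b hb => ?_
    obtain ⟨δ, hδ, h⟩ := exists_forall_le_norm_sub (hP b hb)
    obtain ⟨ρ, hρ, h'⟩ := hfwd b hb δ hδ h
    exact ⟨ρ, hρ, fun x hx => h' x (by simpa [dist_eq_norm] using hx)⟩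
  · obtain ⟨a, ha⟩ := hne
    exact ⟨a, hP a ha, ha⟩
  · rintro b ⟨hbc, hb⟩
    obtain ⟨δ, hδ, h⟩ := exists_forall_le_norm_sub hb
    obtain ⟨ρ, hρ, h'⟩ := hbwd b hb hbc δ hδ h
    obtain ⟨x, hx, hxb⟩ := Metric.mem_closure_iff.1 hbc ρ hρ
    exact h' x (by rwa [dist_comm, dist_eq_norm] at hxb) hx

theorem exists_far_notMem (M : ℝ) : ∃ b ∉ K, M < ‖b‖ := by
  refine ⟨((max M ‖coordMap K‖ + 1 : ℝ) : ℂ), fun h => ?_, ?_⟩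
  · have := (coordMap K).norm_coe_le_norm ⟨_, h⟩
    have h2 := le_max_right M ‖coordMap K‖
    simp only [ContinuousMap.coe_mk, Complex.norm_real, Real.norm_eq_abs] at this
    have := le_abs_self (max M ‖coordMap K‖ + 1)
    linarith
  · rw [Complex.norm_real, Real.norm_eq_abs]
    have := le_abs_self (max M ‖coordMap K‖ + 1)
    have h2 := le_max_left M ‖coordMap K‖
    linarith

-- Quarter steps are reversible: `δ / 4` is at most half of `3 / 4 * δ`, so a move allowed from `b`
-- to `b'` is also allowed back.
omit [CompactSpace K] in
theorem le_norm_sub_of_near {b b' : ℂ} {δ : ℝ} (hb : ∀ z ∈ K, δ ≤ ‖z - b‖) (h : ‖b' - b‖ ≤ δ / 4) :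
    ∀ z ∈ K, 3 / 4 * δ ≤ ‖z - b'‖ := fun z hz => by
  have h1 := hb z hz
  have h2 : ‖z - b‖ ≤ ‖z - b'‖ + ‖b' - b‖ := by
    simpa using norm_add_le (z - b') (b' - b)
  linarith

theorem exists_polyClosure_inv_sub (hKc : IsConnected Kᶜ) {b : ℂ} (hb : b ∉ K) :
    ∃ u ∈ polyClosure K, ∀ z : K, u z = (z - b)⁻¹ := by
  refine (compl_subset_of_step hKc (P := fun b => b ∉ K ∧
    ∃ u ∈ polyClosure K, ∀ z : K, u z = (z - b)⁻¹) (fun b h => h.1) ?_ ?_ ?_ b hb).2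
  · obtain ⟨a, ha, h⟩ := exists_far_notMem (K := K) ‖coordMap K‖
    exact ⟨a, ha, exists_polyClosure_inv_sub_of_far h⟩
  · rintro b ⟨hb, h⟩ δ hδ hd
    refine ⟨δ / 4, by positivity, fun b' hb' => ⟨fun hmem => ?_,
      exists_polyClosure_inv_sub_of_near hδ hd (by linarith) h⟩⟩
    have := le_norm_sub_of_near hd hb'.le b' hmem
    simp at this
    linarith
  · rintro b hb - δ hδ hd
    refine ⟨δ / 4, by positivity, fun b' hb' h => ⟨hb,
      exists_polyClosure_inv_sub_of_near (δ := 3 / 4 * δ) (by positivity)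
        (le_norm_sub_of_near hd hb'.le) ?_ h.2⟩⟩
    rw [norm_sub_rev]
    linarith

/-- Gelfand theory: a non-unit is killed by some character `φ`. The value of `φ` at the coordinate
lies in `K`, since `z - b` is invertible for `b ∉ K`. Polynomials are dense, so `φ` is evaluation at
that point, and a non-unit must vanish somewhere on `K`. -/
theorem exists_polyClosure_inv (hKc : IsConnected Kᶜ) {u : C(K, ℂ)} (hu : u ∈ polyClosure K)
    (h0 : ∀ z, u z ≠ 0) : ∃ v ∈ polyClosure K, ∀ z, v z = (u z)⁻¹ := by
  have : CompleteSpace (polyClosure K) := isClosed_polyClosure.completeSpace_coe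
  by_cases hunit : IsUnit (⟨u, hu⟩ : polyClosure K)
  · obtain ⟨w, hw⟩ := hunit
    refine ⟨((w⁻¹ : (polyClosure K)ˣ) : polyClosure K), Subtype.property _, fun z => ?_⟩
    have h1 := congrArg (fun s : polyClosure K => (s : C(K, ℂ)) z) w.inv_mul
    rw [hw] at h1
    exact eq_inv_of_mul_eq_one_left (by simpa using h1)
  exfalso
  obtain ⟨φ, hφ⟩ := WeakDual.CharacterSpace.mem_spectrum_iff_exists.1
    (spectrum.zero_mem_iff ℂ |>.2 hunit)
  set x : polyClosure K := ⟨coordMap K, coordMap_mem⟩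
  have hx : φ x ∈ K := by
    by_contra hx
    obtain ⟨v, hv, hv'⟩ := exists_polyClosure_inv_sub hKc hx
    have h1 : (x - algebraMap ℂ _ (φ x)) * ⟨v, hv⟩ = 1 := by
      ext z
      have : (z : ℂ) - φ x ≠ 0 := fun h => hx (sub_eq_zero.1 h ▸ z.2)
      simp [x, hv', this]
    have := congrArg φ h1
    rw [map_mul, map_sub, AlgHomClass.commutes] at this
    simp at this
  let ψ : polyClosure K →ₐ[ℂ] ℂ :=
    (ContinuousMap.evalAlgHom ℂ ℂ (⟨φ x, hx⟩ : K)).comp (polyClosure K).val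
  have key : ∀ w : polyClosure K, φ w = ψ w := by
    have hψ : Continuous ψ :=
      (continuous_eval_const (F := C(K, ℂ)) (⟨φ x, hx⟩ : K)).comp continuous_subtype_val
    have hpoly : ∀ p : Polynomial ℂ, φ (Polynomial.aeval x p) = ψ (Polynomial.aeval x p) := fun p => by
      rw [← Polynomial.aeval_algHom_apply, ← Polynomial.aeval_algHom_apply]
      rfl
    have hdense : Dense (Set.range fun p : Polynomial ℂ => Polynomial.aeval x p) := by
      intro w
      rw [Metric.mem_closure_range_iff]
      intro ε hε
      obtain ⟨p, hp⟩ := exists_polynomial_of_mem_polyClosure w.2 (half_pos hε)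
      refine ⟨p, lt_of_le_of_lt ?_ (half_lt_self hε)⟩
      rw [Subtype.dist_eq, ContinuousMap.dist_le (half_pos hε).le]
      intro z
      have h1 : ((Polynomial.aeval x p : polyClosure K) : C(K, ℂ)) z = p.eval (z : ℂ) := by
        have := Polynomial.aeval_algHom_apply
          ((ContinuousMap.evalAlgHom ℂ ℂ z).comp (polyClosure K).val) x p
        exact this.symm.trans (by simp [x, Polynomial.aeval_def, Polynomial.eval₂_eq_eval_map])
      rw [h1, dist_comm, dist_eq_norm]
      exact (hp z).le
    have hφ : Continuous φ := map_continuous φ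
    exact fun w => congrFun (hφ.ext_on hdense hψ (by rintro _ ⟨p, rfl⟩; exact hpoly p)) w
  exact h0 _ ((key _).symm.trans hφ)

end

/-! ### Square root branches and peak functions -/

section
variable {K : Set ℂ} [CompactSpace K]

/-- The conclusion is the sector `|arg w| < π / 4`. Two such arguments add up to less than `π / 2`,
so principal square roots can be multiplied without leaving the right half-plane. -/
theorem re_pos_of_sq_re_pos {w : ℂ} (h : 0 < w.re) (h2 : 0 < (w ^ 2).re) : |w.im| < w.re := by
  rw [pow_two, Complex.mul_re] at h2
  exact abs_lt_of_sq_lt_sq (by nlinarith) h.le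

theorem mul_re_pos {v w : ℂ} (hv : |v.im| < v.re) (hw : |w.im| < w.re) : 0 < (v * w).re := by
  rw [Complex.mul_re]
  have h1 := abs_mul v.im w.im
  have h2 := le_abs_self (v.im * w.im)
  nlinarith [abs_nonneg v.im, abs_nonneg w.im]

theorem div_sub_re_pos {a b c z : ℂ} {r : ℝ} (hr : 0 < r) (ha : ‖a - c‖ < r) (hb : ‖b - c‖ < r)
    (hz : 4 * r ≤ ‖z - c‖) : 0 < ((z - a) / (z - b)).re := by
  have h1 : ‖z - c‖ ≤ ‖z - b‖ + ‖b - c‖ := by simpa using norm_add_le (z - b) (b - c)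
  have h2 : ‖b - a‖ ≤ ‖b - c‖ + ‖a - c‖ := by simpa using norm_sub_le (b - c) (a - c)
  have h0 : z - b ≠ 0 := norm_pos_iff.1 (by linarith)
  have h3 : (z - a) / (z - b) = 1 + (b - a) / (z - b) := by field_simp; ring
  have h4 : ‖(b - a) / (z - b)‖ < 1 := by
    rw [norm_div, div_lt_one (by linarith)]
    linarith
  have h5 := (abs_le.1 (Complex.abs_re_le_norm ((b - a) / (z - b)))).1
  rw [h3, Complex.add_re, Complex.one_re]
  linarith

/-- `b` can be joined to `a` so that `(z - a) / (z - b)` has a square root in the uniform closure of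
the polynomials which is the principal one away from `c`. -/
def HasSqrtBranch (K : Set ℂ) [CompactSpace K] (a c : ℂ) (r : ℝ) (b : ℂ) : Prop :=
  ∃ g ∈ polyClosure K, (∀ z : K, g z ^ 2 = (z - a) / (z - b)) ∧
    ∀ z : K, 4 * r ≤ ‖(z : ℂ) - c‖ → 0 < (g z).re

/-- The old branch is multiplied by the principal square root of `(z - b) / (z - b') = 1 + (b' - b)
/ (z - b')`, which is holomorphic in a quantity of norm at most `1 / 2`. Away from `c` both squares
have positive real part, so both factors lie in the sector of angle `π / 4`. -/
theorem HasSqrtBranch.step (hKc : IsConnected Kᶜ) {a b b' c : ℂ} {r δ : ℝ} (hr : 0 < r)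
    (hδ : 0 < δ) (ha : ‖a - c‖ < r) (hb : ‖b - c‖ < r) (hb' : ‖b' - c‖ < r)
    (hd : ∀ z ∈ K, δ ≤ ‖z - b‖) (hd' : ∀ z ∈ K, δ ≤ ‖z - b'‖) (hbb : ‖b' - b‖ ≤ δ / 2)
    (h : HasSqrtBranch K a c r b) : HasSqrtBranch K a c r b' := by
  obtain ⟨g, hg, hg2, hgre⟩ := h
  have hne : ∀ {x : ℂ}, (∀ z ∈ K, δ ≤ ‖z - x‖) → ∀ z : K, (z : ℂ) - x ≠ 0 := fun hx z =>
    norm_pos_iff.1 (hδ.trans_le (hx z z.2))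
  obtain ⟨u, hu, hu'⟩ := exists_polyClosure_inv_sub hKc (b := b') fun hmem =>
    hne hd' ⟨b', hmem⟩ (sub_self _)
  have ht := (polyClosure K).smul_mem hu (b' - b)
  have htn : ‖(b' - b) • u‖ ≤ 1 / 2 :=
    norm_le_half_of_eq_div_sub hδ hd' (fun z => by simp [hu', div_eq_mul_inv]) hbb
  have hslit : ∀ w : ℂ, ‖w‖ < 1 → 1 + w ∈ Complex.slitPlane := fun w hw =>
    Complex.mem_slitPlane_of_norm_lt_one hw
  obtain ⟨s, hs, hs'⟩ := Subalgebra.exists_mem_eq_comp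
    (h := fun w => Complex.exp (Complex.log (1 + w) / 2)) (R := 3 / 4)
    isClosed_polyClosure ht (by
      intro w hw
      have := hslit w (by simp at hw; linarith)
      exact DifferentiableAt.differentiableWithinAt (by fun_prop (disch := assumption)))
      (htn.trans_lt (by norm_num))
  have ht1 : ∀ z : K, ‖((b' - b) • u) z‖ < 1 := fun z =>
    ((((b' - b) • u).norm_coe_le_norm z).trans htn).trans_lt (by norm_num)
  have hsq : ∀ z : K, s z ^ 2 = (z - b) / (z - b') := fun z => by
    rw [hs', ← Complex.exp_nat_mul, Nat.cast_ofNat, mul_div_cancel₀ _ two_ne_zero,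
      Complex.exp_log (Complex.slitPlane_ne_zero (hslit _ (ht1 z)))]
    have := hne hd' z
    simp only [ContinuousMap.smul_apply, hu', smul_eq_mul]
    field_simp
    ring
  have hsre : ∀ z : K, 0 < (s z).re := fun z => by
    rw [hs', Complex.exp_re]
    refine mul_pos (Real.exp_pos _) (Real.cos_pos_of_mem_Ioo ?_)
    have h1 := Complex.neg_pi_lt_log_im (1 + ((b' - b) • u) z)
    have h2 := Complex.log_im_le_pi (1 + ((b' - b) • u) z)
    have h3 := Complex.mem_slitPlane_iff_arg.1 (hslit _ (ht1 z))
    rw [Complex.log_im] at h1 h2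
    have h4 := lt_of_le_of_ne h2 h3.1
    have h5 : (Complex.log (1 + ((b' - b) • u) z) / 2).im = (1 + ((b' - b) • u) z).arg / 2 := by
      rw [show (2 : ℂ) = ((2 : ℝ) : ℂ) by norm_num, Complex.div_ofReal_im, Complex.log_im]
    rw [h5]
    constructor <;> linarith
  refine ⟨g * s, (polyClosure K).mul_mem hg hs, fun z => ?_, fun z hz => ?_⟩
  · rw [ContinuousMap.mul_apply, mul_pow, hg2, hsq]
    have := hne hd z
    have := hne hd' z
    field_simp
  · refine mul_re_pos (re_pos_of_sq_re_pos (hgre z hz) ?_) (re_pos_of_sq_re_pos (hsre z) ?_)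
    · rw [hg2]; exact div_sub_re_pos hr ha hb hz
    · rw [hsq]; exact div_sub_re_pos hr hb hb' hz

/-- Start from `b = a` with `g = 1` and move `b` off `K`. If no admissible `b` lay in the annulus,
the reachable points would stay within `r / 2` of `c` and yet, by connectedness, exhaust the
unbounded complement. -/
theorem exists_hasSqrtBranch (hKc : IsConnected Kᶜ) {a c : ℂ} {r : ℝ} (hr : 0 < r) (haK : a ∉ K)
    (ha : ‖a - c‖ < r / 2) : ∃ b ∉ K, r / 2 ≤ ‖b - c‖ ∧ ‖b - c‖ < r ∧ HasSqrtBranch K a c r b := by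
  by_contra! hcon
  obtain ⟨x, hx, hxc⟩ := exists_far_notMem (K := K) (‖c‖ + r)
  have hclosed : IsClosed {b : ℂ | ‖b - c‖ ≤ r / 2} := isClosed_le (by fun_prop) (by fun_prop)
  have := compl_subset_of_step hKc
    (P := fun b => b ∉ K ∧ ‖b - c‖ < r / 2 ∧ HasSqrtBranch K a c r b) (fun b h => h.1)
    ⟨a, haK, ha, 1, (polyClosure K).one_mem, fun z => ?_, fun z _ => by simp⟩ ?_ ?_ x hx
  · have h1 := norm_sub_norm_le x c
    linarith [this.2.1]
  · rw [ContinuousMap.one_apply, div_self, one_pow]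
    exact fun h => haK (sub_eq_zero.1 h ▸ z.2)
  · rintro b ⟨hb, hbc, h⟩ δ hδ hd
    -- The bound `r / 2` keeps `b'` within `r` of `c`, where the step lemma applies; `hcon` then
    -- forces `b'` back into the inner disc.
    refine ⟨min (δ / 4) (r / 2), by positivity, fun b' hb' => ?_⟩
    have hb1 := hb'.le.trans (min_le_left _ _)
    have hd' := le_norm_sub_of_near hd hb1
    have hbK : b' ∉ K := fun hmem => by
      have := hd' b' hmem
      simp at this
      linarith
    have hbr : ‖b' - c‖ < r := by
      have : ‖b' - c‖ ≤ ‖b' - b‖ + ‖b - c‖ := by simpa using norm_add_le (b' - b) (b - c)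
      linarith [min_le_right (δ / 4) (r / 2)]
    have hB : HasSqrtBranch K a c r b' :=
      h.step hKc hr (δ := 3 / 4 * δ) (by positivity) (by linarith) (by linarith) hbr
        (fun z hz => by linarith [hd z hz]) hd' (by linarith)
    refine ⟨hbK, ?_, hB⟩
    by_contra! hge
    exact hcon b' hbK hge hbr hB
  · rintro b hb hbcl δ hδ hd
    have hbc : ‖b - c‖ ≤ r / 2 :=
      closure_minimal (fun y hy => hy.2.1.le) hclosed hbcl
    refine ⟨δ / 4, by positivity, fun b' hb' h => ?_⟩
    have hB : HasSqrtBranch K a c r b :=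
      h.2.2.step hKc hr (δ := 3 / 4 * δ) (by positivity) (by linarith) (by linarith [h.2.1])
        (by linarith) (le_norm_sub_of_near hd hb'.le) (fun z hz => by linarith [hd z hz])
        (by rw [norm_sub_rev]; linarith)
    refine ⟨hb, ?_, hB⟩
    by_contra! hge
    exact hcon b hb hge (by linarith) hB

/-- At every scale `r` there is a bounded element of the uniform closure of the polynomials
that is not small at `c` and decays at a rate `r / |z - c|`. -/
theorem exists_polyClosure_peak (hKc : IsConnected Kᶜ) (hKi : interior K = ∅) (c : K) {r : ℝ}
    (hr : 0 < r) : ∃ F ∈ polyClosure K, 1 / 3 ≤ ‖F c‖ ∧ ∀ z : K, ‖F z‖ ≤ 121 ∧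
      ‖F z‖ * ‖(z : ℂ) - c‖ ≤ 484 * r := by
  obtain ⟨a, haK, ha⟩ : ∃ a ∉ K, ‖a - c‖ < r / 8 := by
    have h1 : (c : ℂ) ∈ closure Kᶜ := by
      rw [closure_compl, hKi, Set.compl_empty]; trivial
    obtain ⟨a, ha, h⟩ := Metric.mem_closure_iff.1 h1 (r / 8) (by positivity)
    exact ⟨a, ha, by rwa [dist_comm, dist_eq_norm] at h⟩
  obtain ⟨b, hbK, hb1, hb2, g, hg, hg2, hgre⟩ :=
    exists_hasSqrtBranch (K := K) (c := c) hKc hr haK (by linarith)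
  have hne : ∀ z : K, (z : ℂ) - b ≠ 0 := fun z h => hbK (sub_eq_zero.1 h ▸ z.2)
  have hba : ‖b - a‖ ≤ ‖b - c‖ + ‖a - c‖ := by simpa using norm_sub_le (b - c) (a - c)
  have hba' : ‖b - c‖ ≤ ‖b - a‖ + ‖a - c‖ := by simpa using norm_add_le (b - a) (a - c)
  -- From `1 - g ^ 2 = (a - b) / (z - b)`. This identity gives both the lower bound on `1 + g` near
  -- `c` and the decay of the peak far from `c`.
  have hprod : ∀ z : K, ‖1 - g z‖ * ‖1 + g z‖ = ‖b - a‖ / ‖(z : ℂ) - b‖ := fun z => by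
    rw [← norm_mul, ← norm_div, ← norm_neg]
    congr 1
    have h1 := hg2 z
    have h2 := hne z
    field_simp at h1 ⊢
    linear_combination h1
  have htri : ∀ z : K, ‖1 - g z‖ ≤ 2 + ‖1 + g z‖ := fun z => by
    have := norm_sub_le (2 : ℂ) (1 + g z)
    rwa [show (2 : ℂ) - (1 + g z) = 1 - g z by ring, Complex.norm_ofNat] at this
  have hone : ∀ z : K, 4 * r ≤ ‖(z : ℂ) - c‖ → 1 ≤ ‖1 + g z‖ := fun z hz => by
    have h1 := Complex.re_le_norm (1 + g z)
    rw [Complex.add_re, Complex.one_re] at h1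
    linarith [hgre z hz]
  have hlow : ∀ z : K, 1 / 60 ≤ ‖1 + g z‖ := fun z => by
    rcases le_or_gt (4 * r) ‖(z : ℂ) - c‖ with hz | hz
    · linarith [hone z hz]
    · by_contra! hlt
      have h1 : ‖(z : ℂ) - b‖ ≤ ‖(z : ℂ) - c‖ + ‖b - c‖ := by
        simpa using norm_sub_le ((z : ℂ) - c) (b - c)
      -- Here `‖b - a‖ ≥ r / 2 - r / 8` and `‖z - b‖ ≤ 5 * r`. With `‖1 + g z‖ < 1 / 60` the product
      -- in `hprod` would be below `1 / 20`.
      have h2 : 1 / 20 ≤ ‖b - a‖ / ‖(z : ℂ) - b‖ := by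
        rw [le_div_iff₀ (norm_pos_iff.2 (hne z))]
        linarith
      rw [← hprod] at h2
      nlinarith [htri z, norm_nonneg (1 - g z), norm_nonneg (1 + g z)]
  obtain ⟨v, hv, hv'⟩ := exists_polyClosure_inv hKc
    ((polyClosure K).add_mem (polyClosure K).one_mem hg) fun z h => by
      have := hlow z
      rw [show 1 + g z = 0 from h, norm_zero] at this
      norm_num at this
  have hF : ∀ z : K, ‖((1 - g) * v) z‖ = ‖1 - g z‖ / ‖1 + g z‖ := fun z => by
    simp [hv', div_eq_mul_inv]
  have hpos : ∀ z : K, 0 < ‖1 + g z‖ := fun z => lt_of_lt_of_le (by norm_num) (hlow z)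
  have hbd : ∀ z : K, ‖((1 - g) * v) z‖ ≤ 121 := fun z => by
    rw [hF, div_le_iff₀ (hpos z)]
    linarith [htri z, hlow z]
  refine ⟨(1 - g) * v, (polyClosure K).mul_mem ((polyClosure K).sub_mem
    (polyClosure K).one_mem hg) hv, ?_, fun z => ⟨hbd z, ?_⟩⟩
  · rw [hF, le_div_iff₀ (hpos c)]
    -- Since `a` is within `r / 8` of `c` and `b` is at least `r / 2` away, `‖g c‖ ≤ 1 / 2`, so the
    -- quotient at `c` is at least `(1 / 2) / (3 / 2)`.
    have h1 : ‖g c‖ ^ 2 ≤ (1 / 2) ^ 2 := by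
      rw [← norm_pow, hg2, norm_div, div_le_iff₀ (norm_pos_iff.2 (hne c)), norm_sub_rev,
        norm_sub_rev (c : ℂ)]
      linarith
    have h2 : ‖g c‖ ≤ 1 / 2 := le_of_sq_le_sq h1 (by norm_num)
    have h3 := norm_sub_norm_le 1 (g c)
    have h4 := norm_add_le 1 (g c)
    rw [norm_one] at h3 h4
    linarith
  · rcases le_or_gt (4 * r) ‖(z : ℂ) - c‖ with hz | hz
    · have h1 := hone z hz
      have h2 : ‖(z : ℂ) - c‖ ≤ ‖(z : ℂ) - b‖ + ‖b - c‖ := by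
        simpa using norm_add_le ((z : ℂ) - b) (b - c)
      have h3 : ‖((1 - g) * v) z‖ ≤ ‖b - a‖ / ‖(z : ℂ) - b‖ := by
        rw [hF, ← hprod]
        exact (div_le_self (norm_nonneg _) h1).trans (le_mul_of_one_le_right (norm_nonneg _) h1)
      have h4 := norm_pos_iff.2 (hne z)
      rw [le_div_iff₀ h4] at h3
      nlinarith [norm_nonneg (((1 - g) * v) z)]
    · nlinarith [hbd z, norm_nonneg (((1 - g) * v) z), norm_nonneg ((z : ℂ) - c)]

end

section
variable {K : Set ℂ} [CompactSpace K]

/-- For every point `c` of the plane and every scale `r` there is a polynomial with value `1` at `c`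
that is bounded on `K` and decays at a rate `r / |z - c|`, with an absolute constant. -/
theorem exists_polynomial_peak (hKc : IsConnected Kᶜ) (hKi : interior K = ∅) :
    ∃ C > 0, ∀ c : ℂ, ∀ r > 0, ∃ p : Polynomial ℂ, p.eval c = 1 ∧
      ∀ z ∈ K, ‖p.eval z‖ ≤ C ∧ ‖p.eval z‖ * ‖z - c‖ ≤ C * r := by
  -- The `4` normalises the value at `c`, and `485 = 484 + 1` absorbs the error of polynomial
  -- approximation.
  refine ⟨4 * 485, by norm_num, fun c r hr => ?_⟩
  set M := ‖coordMap K‖ + ‖c‖ + 1 with hM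
  have hMpos : 0 < M := by positivity
  have hbd : ∀ z ∈ K, ‖z - c‖ ≤ M := fun z hz => by
    have h1 := (coordMap K).norm_coe_le_norm ⟨z, hz⟩
    have h2 := norm_sub_le z c
    simp only [ContinuousMap.coe_mk] at h1
    linarith
  by_cases hc : c ∈ K
  · obtain ⟨F, hF, hFc, hFz⟩ := exists_polyClosure_peak hKc hKi ⟨c, hc⟩ hr
    obtain ⟨p, hp⟩ := exists_polynomial_of_mem_polyClosure hF
      (ε := min (1 / 12) (r / M)) (by positivity)
    have hpc : 1 / 4 ≤ ‖p.eval c‖ := by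
      have h1 := (hp ⟨c, hc⟩).le.trans (min_le_left _ _)
      have h2 := norm_sub_norm_le (F ⟨c, hc⟩) (p.eval c)
      rw [norm_sub_rev] at h2
      linarith
    have hpos : 0 < ‖p.eval c‖ := by linarith
    have hinv : ‖(p.eval c)⁻¹‖ ≤ 4 := by
      rw [norm_inv, inv_le_comm₀ hpos (by norm_num)]
      linarith
    refine ⟨Polynomial.C (p.eval c)⁻¹ * p, by simp [norm_pos_iff.1 hpos], fun z hz => ?_⟩
    have h1 := (hp ⟨z, hz⟩).le.trans (min_le_left _ _)
    have h2 := (hp ⟨z, hz⟩).le.trans (min_le_right _ _)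
    rw [le_div_iff₀ hMpos] at h2
    have h3 : ‖p.eval z‖ ≤ ‖p.eval z - F ⟨z, hz⟩‖ + ‖F ⟨z, hz⟩‖ := by
      simpa using norm_add_le (p.eval z - F ⟨z, hz⟩) (F ⟨z, hz⟩)
    obtain ⟨h4, h5⟩ := hFz ⟨z, hz⟩
    have h6 := mul_le_mul_of_nonneg_left (hbd z hz) (norm_nonneg (p.eval z - F ⟨z, hz⟩))
    have h7 := mul_le_mul_of_nonneg_right h3 (norm_nonneg (z - c))
    simp only at h1 h2 h5
    rw [Polynomial.eval_mul, Polynomial.eval_C, norm_mul]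
    constructor
    · exact mul_le_mul hinv (by linarith) (norm_nonneg _) (by norm_num)
    · rw [mul_assoc, mul_assoc]
      exact mul_le_mul hinv (by linarith) (by positivity) (by norm_num)
  · obtain ⟨u, hu, hu'⟩ := exists_polyClosure_inv_sub hKc hc
    obtain ⟨s, hs⟩ := exists_polynomial_of_mem_polyClosure hu
      (ε := min (1 / M) (r / M ^ 2)) (by positivity)
    -- This is `1` at `c` for any `s`, and equals `(z - c) * (u - s)` on `K`, which is small because
    -- `s` approximates `u = 1 / (z - c)`.
    refine ⟨1 - (Polynomial.X - Polynomial.C c) * s, by simp, fun z hz => ?_⟩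
    have hzc : z - c ≠ 0 := fun h => hc (sub_eq_zero.1 h ▸ hz)
    have h0 : ‖(1 - (Polynomial.X - Polynomial.C c) * s).eval z‖ =
        ‖z - c‖ * ‖s.eval z - u ⟨z, hz⟩‖ := by
      rw [← norm_mul, ← norm_neg, hu']
      congr 1
      simp only [Polynomial.eval_sub, Polynomial.eval_one, Polynomial.eval_mul, Polynomial.eval_X,
        Polynomial.eval_C]
      field_simp
      ring
    have h1 := (hs ⟨z, hz⟩).le.trans (min_le_left _ _)
    have h2 := (hs ⟨z, hz⟩).le.trans (min_le_right _ _)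
    rw [le_div_iff₀ (by positivity)] at h1 h2
    have h3 := hbd z hz
    have h4 := norm_nonneg (z - c)
    have h5 := norm_nonneg (s.eval z - u ⟨z, hz⟩)
    simp only at h1 h2
    rw [h0]
    constructor
    · nlinarith
    · have : ‖z - c‖ ^ 2 ≤ M ^ 2 := by gcongr
      nlinarith

end

/-! ### The Cauchy transform of a disc -/

section

open Real

theorem integrableOn_polarCoord_symm {f : ℂ → ℂ} (hf : Integrable f) (hm : Measurable f) :
    IntegrableOn (fun p : ℝ × ℝ => p.1 • f (Complex.polarCoord.symm p)) polarCoord.target := by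
  have hms : Measurable fun p : ℝ × ℝ => Complex.polarCoord.symm p := by
    simp only [Complex.polarCoord_symm_apply]
    fun_prop
  refine ⟨(measurable_fst.smul (hm.comp hms)).aestronglyMeasurable, ?_⟩
  have h1 := Complex.lintegral_comp_polarCoord_symm fun z => ‖f z‖ₑ
  have h2 : ∫⁻ z, ‖f z‖ₑ < ⊤ := hf.2
  rw [← h1] at h2
  refine lt_of_eq_of_lt ?_ h2
  refine setLIntegral_congr_fun (polarCoord.open_target.measurableSet) fun p hp => ?_
  have : 0 < p.1 := hp.1
  simp only [enorm_smul, smul_eq_mul]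
  rw [Real.enorm_eq_ofReal this.le]

theorem integral_eq_integral_circleAverage {f : ℂ → ℂ} (hf : Integrable f) (hm : Measurable f) :
    ∫ z, f z = ∫ s in Set.Ioi (0 : ℝ), (2 * π * s) • circleAverage f 0 s := by
  rw [← Complex.integral_comp_polarCoord_symm]
  have h := integrableOn_polarCoord_symm hf hm
  have ht : polarCoord.target = Set.Ioi (0 : ℝ) ×ˢ Set.Ioo (-π) π := rfl
  rw [ht, Measure.volume_eq_prod] at h ⊢
  rw [setIntegral_prod _ h]
  refine setIntegral_congr_fun measurableSet_Ioi fun s _ => ?_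
  simp only
  rw [integral_smul, ← integral_Ioc_eq_integral_Ioo,
    ← intervalIntegral.integral_of_le (by linarith [pi_pos]), circleAverage_eq_integral_add (-π),
    smul_smul, mul_comm (2 * π) s, mul_assoc, mul_inv_cancel₀ (by positivity), mul_one,
    intervalIntegral.integral_comp_add_right (fun θ => f (circleMap 0 s θ)), zero_add,
    show 2 * π + -π = π by ring]
  congr 1
  refine intervalIntegral.integral_congr fun θ _ => ?_
  simp [circleMap, Complex.exp_mul_I]

theorem circleAverage_inv_sub_of_lt {z : ℂ} {s : ℝ} (hs : 0 < s) (h : s < ‖z‖) :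
    circleAverage (fun w => (z - w)⁻¹) 0 s = z⁻¹ := by
  have hd : DiffContOnCl ℂ (fun w => (z - w)⁻¹) (ball 0 |s|) := by
    refine DifferentiableOn.diffContOnCl ?_
    refine DifferentiableOn.inv (by fun_prop) fun w hw h0 => ?_
    have := closure_ball_subset_closedBall hw
    rw [← sub_eq_zero.1 h0, abs_of_pos hs] at this
    simp at this
    linarith
  simpa using hd.circleAverage

/-- Write `1 / (z - w) = z⁻¹ * (1 - w / (w - z))`; the average of `w / (w - z)` is `1` by Cauchy's
formula. -/
theorem circleAverage_inv_sub_of_gt {z : ℂ} {s : ℝ} (hz : z ≠ 0) (h : ‖z‖ < s) :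
    circleAverage (fun w => (z - w)⁻¹) 0 s = 0 := by
  have hs : 0 < s := (norm_nonneg z).trans_lt h
  have hne : ∀ w ∈ sphere (0 : ℂ) |s|, w - z ≠ 0 := fun w hw h0 => by
    rw [sub_eq_zero.1 h0, abs_of_pos hs] at hw
    simp at hw
    linarith
  have h1 : circleAverage (fun w => ((w - 0) / (w - z)) • (1 : ℂ)) 0 s = 1 :=
    DiffContOnCl.circleAverage_smul_div diffContOnCl_const (by simpa [abs_of_pos hs] using h)
  have h2 : circleAverage (fun w => (z - w)⁻¹) 0 s =
      circleAverage (fun w => z⁻¹ • ((fun _ => (1 : ℂ)) w - ((w - 0) / (w - z)) • (1 : ℂ))) 0 s := by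
    refine circleAverage_congr_sphere fun w hw => ?_
    have h3 := hne w hw
    have h4 : z - w ≠ 0 := fun h => h3 (by rw [← neg_sub, h, neg_zero])
    simp only [smul_eq_mul, sub_zero, mul_one]
    field_simp
    ring
  have hci : CircleIntegrable (fun w => ((w - 0) / (w - z)) • (1 : ℂ)) 0 s := by
    refine ContinuousOn.circleIntegrable' ?_
    refine ContinuousOn.smul (ContinuousOn.div (by fun_prop) (by fun_prop) hne) (by fun_prop)
  have h5 := circleAverage_sub (f₁ := fun _ => (1 : ℂ)) (circleIntegrable_const 1 0 s) hci
  rw [h2, circleAverage_fun_smul]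
  rw [h1, circleAverage_const, sub_self] at h5
  rw [show circleAverage (fun w => (fun _ => (1 : ℂ)) w - ((w - 0) / (w - z)) • (1 : ℂ)) 0 s = 0
    from h5, smul_zero]

theorem integrable_indicator_comp_sub_left {E : Type*} [NormedAddCommGroup E] {h : ℂ → E}
    (hh : LocallyIntegrable h) (z : ℂ) (ρ : ℝ) :
    Integrable fun w => (ball (0 : ℂ) ρ).indicator h (z - w) :=
  Integrable.comp_sub_left ((integrable_indicator_iff measurableSet_ball).2
    ((hh.integrableOn_isCompact (isCompact_closedBall 0 ρ)).mono_set ball_subset_closedBall)) z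

theorem integrableOn_comp_sub_left {E : Type*} [NormedAddCommGroup E] {h : ℂ → E}
    (hh : LocallyIntegrable h) (z : ℂ) {s : Set ℂ} (hs : Bornology.IsBounded s) :
    IntegrableOn (fun w => h (z - w)) s := by
  obtain ⟨ρ, hρ⟩ := hs.subset_ball z
  refine IntegrableOn.mono_set ?_ hρ
  refine (integrable_indicator_comp_sub_left hh z ρ).integrableOn.congr_fun (fun w hw => ?_)
    measurableSet_ball
  rw [mem_ball, dist_comm, dist_eq_norm] at hw
  simp [hw]

theorem locallyIntegrable_inv : LocallyIntegrable fun w : ℂ => w⁻¹ :=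
  locallyIntegrable_of_norm_le_rpow (C := 1) (α := 1) (by simp) (by simp)
    (Eventually.of_forall fun w => by simp [Real.rpow_neg_one]) (by fun_prop)

/-- The kernel `‖w‖ ^ (-3/2)`. -/
noncomputable def weakKernel (w : ℂ) : ℝ := (√‖w‖ * ‖w‖)⁻¹

theorem weakKernel_nonneg (w : ℂ) : 0 ≤ weakKernel w := by unfold weakKernel; positivity

theorem locallyIntegrable_weakKernel : LocallyIntegrable weakKernel := by
  refine locallyIntegrable_of_norm_le_rpow (C := 1) (α := 3 / 2) (by simp) (by norm_num)
    (Eventually.of_forall fun w => ?_) (Measurable.aestronglyMeasurable (by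
      unfold weakKernel; fun_prop))
  rw [Real.norm_of_nonneg (weakKernel_nonneg w), weakKernel, one_mul,
    Real.rpow_neg (norm_nonneg w), Real.sqrt_eq_rpow]
  rcases eq_or_ne w 0 with rfl | hw
  · simp
  · nth_rewrite 2 [← Real.rpow_one ‖w‖]
    rw [← Real.rpow_add (norm_pos_iff.2 hw)]
    norm_num

theorem setIntegral_weakKernel_le {z : ℂ} {R : ℝ} (hz : ‖z‖ < R) :
    ∫ w in ball (0 : ℂ) R, weakKernel (z - w) ≤ ∫ w in ball (0 : ℂ) (2 * R), weakKernel w := by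
  have h1 := integrable_indicator_comp_sub_left locallyIntegrable_weakKernel z (2 * R)
  rw [← integral_indicator (s := ball (0 : ℂ) (2 * R)) measurableSet_ball,
    ← integral_sub_left_eq_self ((ball (0 : ℂ) (2 * R)).indicator weakKernel) volume z, ← integral_indicator measurableSet_ball]
  refine integral_mono_of_nonneg (Eventually.of_forall fun w => ?_) h1
    (Eventually.of_forall fun w => ?_)
  · exact Set.indicator_nonneg (fun w _ => weakKernel_nonneg _) w
  · by_cases hw : ‖w‖ < R
    · have : ‖z - w‖ < 2 * R := (norm_sub_le z w).trans_lt (by linarith)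
      simp [hw, this]
    · rw [Set.indicator_of_notMem (by simpa using hw)]
      exact Set.indicator_nonneg (fun w _ => weakKernel_nonneg _) _

theorem integrableOn_inv_sub (z : ℂ) {s : Set ℂ} (hs : Bornology.IsBounded s) :
    IntegrableOn (fun w => (z - w)⁻¹) s :=
  integrableOn_comp_sub_left locallyIntegrable_inv z hs

/-- Only circles of radius `s < ‖z‖` contribute, each with average `z⁻¹`, so the integral is `z⁻¹ *
π * ‖z‖ ^ 2`. The case `z = 0` is settled by oddness. -/
theorem integral_ball_inv_sub {z : ℂ} {R : ℝ} (hz : ‖z‖ < R) :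
    ∫ w in ball (0 : ℂ) R, (z - w)⁻¹ = π * (starRingEnd ℂ) z := by
  rw [← integral_indicator measurableSet_ball]
  set f : ℂ → ℂ := (ball (0 : ℂ) R).indicator fun w => (z - w)⁻¹ with hf
  rcases eq_or_ne z 0 with rfl | h0
  · have h1 : ∫ w, f (-w) = ∫ w, f w := integral_neg_eq_self f volume
    have h2 : ∀ w, f (-w) = - f w := fun w => by
      by_cases hw : ‖w‖ < R <;> simp [hf, hw, inv_neg]
    simp only [h2, integral_neg] at h1
    simpa using neg_eq_self.1 h1
  have hint : Integrable f := (integrable_indicator_iff measurableSet_ball).2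
    (integrableOn_inv_sub z isBounded_ball)
  have hm : Measurable f := Measurable.indicator (by fun_prop) measurableSet_ball
  rw [integral_eq_integral_circleAverage hint hm]
  have hfs : ∀ s, 0 < s → s < R → circleAverage f 0 s = circleAverage (fun w => (z - w)⁻¹) 0 s :=
    fun s hs hsR => circleAverage_congr_sphere fun w hw => by
      rw [mem_sphere_zero_iff_norm, abs_of_pos hs] at hw
      simp [hf, hw, hsR]
  have hfs' : ∀ s, R ≤ s → circleAverage f 0 s = 0 := fun s hsR => by
    refine circleAverage_const_on_circle fun w hw => ?_
    have hs : 0 < s := ((norm_nonneg z).trans_lt hz).trans_le hsR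
    rw [mem_sphere_zero_iff_norm, abs_of_pos hs] at hw
    simp [hf, hw, hsR]
  have hae : ∀ᵐ s : ℝ, s ∈ Set.Ioi (0 : ℝ) → (2 * π * s) • circleAverage f 0 s =
      (Set.Iic ‖z‖).indicator (fun s : ℝ => (2 * π * s) • z⁻¹) s := by
    have : ∀ᵐ s : ℝ, s ≠ ‖z‖ := by simp [ae_iff, measure_singleton]
    filter_upwards [this] with s hs hs0
    rcases lt_or_gt_of_ne hs with h | h
    · rw [hfs s hs0 (h.trans hz), circleAverage_inv_sub_of_lt hs0 h, Set.indicator_of_mem]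
      exact h.le
    · rw [Set.indicator_of_notMem (by simpa using h)]
      rcases lt_or_ge s R with h' | h'
      · rw [hfs s hs0 h', circleAverage_inv_sub_of_gt h0 h, smul_zero]
      · rw [hfs' s h', smul_zero]
  rw [setIntegral_congr_ae measurableSet_Ioi hae, setIntegral_indicator measurableSet_Iic,
    Set.Ioi_inter_Iic, ← intervalIntegral.integral_of_le (norm_nonneg z)]
  rw [intervalIntegral.integral_smul_const, intervalIntegral.integral_const_mul, integral_id]
  rw [Complex.real_smul]
  push_cast
  have h3 := Complex.mul_conj' z
  field_simp
  linear_combination -h3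

end

/-! ### Polynomial approximation of the Cauchy transform and Lavrentiev's theorem -/

theorem exists_polynomial_eval_eq_integral_slope (p : Polynomial ℂ) {B : Set ℂ}
    {w : ℂ → ℂ} (hw : ∀ k : ℕ, IntegrableOn (fun ζ => w ζ * ζ ^ k) B) :
    ∃ Q : Polynomial ℂ, ∀ z, Q.eval z =
      ∫ ζ in B, w ζ * ((p.eval z - p.eval ζ) * (z - ζ)⁻¹) := by
  refine ⟨∑ n ∈ Finset.range (p.natDegree + 1), ∑ i ∈ Finset.range n,
    Polynomial.C (p.coeff n * ∫ ζ in B, w ζ * ζ ^ (n - 1 - i)) * Polynomial.X ^ i, fun z => ?_⟩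
  have hI : ∀ n i : ℕ, IntegrableOn
      (fun ζ => p.coeff n * (w ζ * ζ ^ (n - 1 - i)) * z ^ i) B := fun n i =>
    ((hw (n - 1 - i)).const_mul _).mul_const _
  have hae : ∀ᵐ ζ ∂volume.restrict B, w ζ * ((p.eval z - p.eval ζ) * (z - ζ)⁻¹) =
      ∑ n ∈ Finset.range (p.natDegree + 1), ∑ i ∈ Finset.range n,
        p.coeff n * (w ζ * ζ ^ (n - 1 - i)) * z ^ i := by
    have : ∀ᵐ ζ : ℂ ∂volume.restrict B, ζ ≠ z :=
      ae_restrict_of_ae (by simp [ae_iff, measure_singleton])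
    filter_upwards [this] with ζ hζ
    have h0 : z - ζ ≠ 0 := sub_ne_zero.2 hζ.symm
    rw [Polynomial.eval_eq_sum_range, Polynomial.eval_eq_sum_range, ← Finset.sum_sub_distrib,
      Finset.sum_mul, Finset.mul_sum]
    refine Finset.sum_congr rfl fun n _ => ?_
    rw [← mul_sub, ← (Commute.all z ζ).geom_sum₂_mul n, mul_assoc, mul_assoc, mul_inv_cancel₀ h0,
      mul_one, Finset.mul_sum, Finset.mul_sum]
    exact Finset.sum_congr rfl fun i _ => by ring
  rw [integral_congr_ae hae, integral_finsetSum _ fun n _ => integrable_finsetSum _ fun i _ => hI n i,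
    Polynomial.eval_finsetSum]
  refine Finset.sum_congr rfl fun n _ => ?_
  rw [integral_finsetSum _ fun i _ => hI n i, Polynomial.eval_finsetSum]
  refine Finset.sum_congr rfl fun i _ => ?_
  rw [integral_mul_const, integral_const_mul]
  simp

/-- The geometric mean of the two bounds on `‖a‖` is `C * √(2 * r / ‖u‖)`. It trades half a power of
`‖u‖` for a factor `√r` and leaves a kernel still integrable near `0`. -/
theorem norm_mul_inv_mul_inv_le {a b u : ℂ} {C r : ℝ} (hC : 0 < C) (hr : 0 < r) (ha : ‖a‖ ≤ C)
    (hau : ‖a‖ * ‖u‖ ≤ 2 * C * r) (hb : 1 / 2 ≤ ‖b‖) :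
    ‖a * (b⁻¹ * u⁻¹)‖ ≤ 2 * C * √(2 * r) * weakKernel u := by
  rcases eq_or_ne u 0 with rfl | hu
  · simp [weakKernel]
  have hupos := norm_pos_iff.2 hu
  have h1 : ‖b⁻¹‖ ≤ 2 := by
    rw [norm_inv, inv_le_comm₀ (by linarith) (by norm_num)]
    linarith
  have h2 : ‖a‖ * √‖u‖ ≤ C * √(2 * r) := by
    refine le_of_sq_le_sq ?_ (by positivity)
    rw [mul_pow, mul_pow, Real.sq_sqrt hupos.le, Real.sq_sqrt (by positivity)]
    calc ‖a‖ ^ 2 * ‖u‖ = ‖a‖ * (‖a‖ * ‖u‖) := by ring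
      _ ≤ C * (2 * C * r) := mul_le_mul ha hau (by positivity) hC.le
      _ = C ^ 2 * (2 * r) := by ring
  have hs : 0 < √‖u‖ := Real.sqrt_pos.2 hupos
  rw [weakKernel, ← div_eq_mul_inv (2 * C * √(2 * r)), le_div_iff₀ (by positivity), norm_mul, norm_mul, norm_inv u]
  calc ‖a‖ * (‖b⁻¹‖ * ‖u‖⁻¹) * (√‖u‖ * ‖u‖) = ‖b⁻¹‖ * (‖a‖ * √‖u‖) := by field_simp
    _ ≤ 2 * (C * √(2 * r)) := mul_le_mul h1 h2 (by positivity) (by norm_num)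
    _ = _ := by ring

section
variable {K : Set ℂ}

/-- The polynomial integrates `(1 - p z / p ζ) / (z - ζ)`, a slope of `p` weighted by `-1 / p ζ`.
The radius `ρ` ensures `‖p ζ‖ ≥ 1 / 2` and `‖ζ - c‖ ≤ r`, so decay measured from `c` becomes decay
measured from `ζ`, with `2 * C * r`. -/
theorem exists_polynomial_near_integral_of_peak {c : ℂ} {C r : ℝ} (hC : 0 < C) (hr : 0 < r)
    {p : Polynomial ℂ} (hpc : p.eval c = 1)
    (hp : ∀ z ∈ K, ‖p.eval z‖ ≤ C ∧ ‖p.eval z‖ * ‖z - c‖ ≤ C * r) :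
    ∃ ρ > 0, ∀ B ⊆ ball c ρ, MeasurableSet B → ∃ Q : Polynomial ℂ, ∀ z ∈ K,
      ‖(∫ ζ in B, (z - ζ)⁻¹) - Q.eval z‖ ≤
        2 * C * √(2 * r) * ∫ ζ in B, weakKernel (z - ζ) := by
  have hev : ∀ᶠ ζ in 𝓝 c, 1 / 2 < ‖p.eval ζ‖ :=
    (p.continuous.norm.tendsto c).eventually (lt_mem_nhds (by rw [hpc]; norm_num))
  obtain ⟨ρ', hρ', hball⟩ := Metric.eventually_nhds_iff_ball.1 hev
  refine ⟨min (ρ' / 2) r, by positivity, fun B hB hBm => ?_⟩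
  have hBb : Bornology.IsBounded B := isBounded_ball.subset hB
  have hsub : closedBall c (min (ρ' / 2) r) ⊆ ball c ρ' :=
    closedBall_subset_ball ((min_le_left _ _).trans_lt (half_lt_self hρ'))
  have hne : ∀ ζ ∈ closedBall c (min (ρ' / 2) r), p.eval ζ ≠ 0 := fun ζ hζ h => by
    have := hball ζ (hsub hζ)
    rw [h, norm_zero] at this
    norm_num at this
  have hw : ∀ k : ℕ, IntegrableOn (fun ζ => -(p.eval ζ)⁻¹ * ζ ^ k) B := fun k => by
    refine IntegrableOn.mono_set ?_ (hB.trans ball_subset_closedBall)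
    refine ContinuousOn.integrableOn_compact (isCompact_closedBall _ _) ?_
    exact ((p.continuous.continuousOn.inv₀ hne).neg).mul (by fun_prop)
  obtain ⟨Q, hQ⟩ := exists_polynomial_eval_eq_integral_slope p hw
  refine ⟨Q, fun z hz => ?_⟩
  have hI := integrableOn_inv_sub z hBb
  have hlow : ∀ ζ ∈ B, 1 / 2 ≤ ‖p.eval ζ‖ := fun ζ hζ =>
    (hball ζ (hsub (ball_subset_closedBall (hB hζ)))).le
  have hJ : IntegrableOn (fun ζ => p.eval z * ((p.eval ζ)⁻¹ * (z - ζ)⁻¹)) B := by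
    refine Integrable.const_mul (Integrable.bdd_mul hI (c := 2)
      (Measurable.aestronglyMeasurable (p.continuous.measurable.inv)) ?_) _
    refine (ae_restrict_iff' hBm).2 (Eventually.of_forall fun ζ hζ => ?_)
    rw [Pi.inv_apply, norm_inv, inv_le_comm₀ (by linarith [hlow ζ hζ]) (by norm_num)]
    linarith [hlow ζ hζ]
  have h1 : (∫ ζ in B, (z - ζ)⁻¹) - Q.eval z =
      ∫ ζ in B, p.eval z * ((p.eval ζ)⁻¹ * (z - ζ)⁻¹) := by
    rw [hQ, sub_eq_iff_eq_add', ← sub_eq_iff_eq_add, ← integral_sub hI hJ]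
    refine setIntegral_congr_fun hBm fun ζ hζ => ?_
    have := hne ζ (ball_subset_closedBall (hB hζ))
    field_simp
    ring
  rw [h1, ← integral_const_mul]
  refine norm_integral_le_of_norm_le
    ((integrableOn_comp_sub_left locallyIntegrable_weakKernel z hBb).const_mul _)
    ((ae_restrict_iff' hBm).2 (Eventually.of_forall fun ζ hζ => ?_))
  refine norm_mul_inv_mul_inv_le hC hr (hp z hz).1 ?_ (hlow ζ hζ)
  have h2 : ‖z - ζ‖ ≤ ‖z - c‖ + ‖ζ - c‖ := by simpa using norm_sub_le (z - c) (ζ - c)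
  have h3 : ‖ζ - c‖ ≤ r := by
    have := hB hζ
    rw [mem_ball, dist_eq_norm] at this
    exact this.le.trans (min_le_right _ _)
  obtain ⟨h4, h5⟩ := hp z hz
  nlinarith [norm_nonneg (p.eval z)]

theorem exists_polynomial_near_integral [CompactSpace K] (hKc : IsConnected Kᶜ)
    (hKi : interior K = ∅) : ∃ C > 0, ∀ r > 0, ∀ R : ℝ, ∃ Q : Polynomial ℂ, ∀ z ∈ K,
      ‖(∫ ζ in ball 0 R, (z - ζ)⁻¹) - Q.eval z‖ ≤
        2 * C * √(2 * r) * ∫ ζ in ball 0 R, weakKernel (z - ζ) := by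
  obtain ⟨C, hC, hpeak⟩ := exists_polynomial_peak hKc hKi
  refine ⟨C, hC, fun r hr R => ?_⟩
  -- Quantifying over all measurable bounded `B ⊆ S` lets overlapping pieces be cut apart. Errors
  -- are integrals of one kernel over disjoint pieces, so the number of pieces does not enter the
  -- bound.
  obtain ⟨S, hS, -, hQ⟩ := (isCompact_closedBall (0 : ℂ) R).induction_on
    (p := fun T => ∃ S, T ⊆ S ∧ MeasurableSet S ∧ ∀ B ⊆ S, MeasurableSet B →
      Bornology.IsBounded B → ∃ Q : Polynomial ℂ, ∀ z ∈ K,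
      ‖(∫ ζ in B, (z - ζ)⁻¹) - Q.eval z‖ ≤ 2 * C * √(2 * r) * ∫ ζ in B, weakKernel (z - ζ))
    ⟨∅, subset_rfl, MeasurableSet.empty, fun B hB _ _ => ⟨0, fun z _ => by
      simp [Set.subset_empty_iff.1 hB]⟩⟩
    (fun T T' hT ⟨S, hS, h⟩ => ⟨S, hT.trans hS, h⟩)
    (by
      rintro T T' ⟨S, hS, hSm, h⟩ ⟨S', hS', hSm', h'⟩
      refine ⟨S ∪ S', Set.union_subset_union hS hS', hSm.union hSm', fun B hB hBm hBb => ?_⟩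
      obtain ⟨Q, hQ⟩ := h (B ∩ S) Set.inter_subset_right (hBm.inter hSm)
        (hBb.subset Set.inter_subset_left)
      obtain ⟨Q', hQ'⟩ := h' (B \ S) (by
        rintro x ⟨hx, hxS⟩
        exact (hB hx).resolve_left hxS) (hBm.diff hSm) (hBb.subset Set.sdiff_subset)
      refine ⟨Q + Q', fun z hz => ?_⟩
      rw [← integral_inter_add_sdiff hSm (integrableOn_inv_sub z hBb),
        ← integral_inter_add_sdiff hSm
          (integrableOn_comp_sub_left locallyIntegrable_weakKernel z hBb),
        Polynomial.eval_add, add_sub_add_comm, mul_add]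
      exact (norm_add_le _ _).trans (add_le_add (hQ z hz) (hQ' z hz)))
    (fun c _ => by
      obtain ⟨p, hpc, hp⟩ := hpeak c r hr
      obtain ⟨ρ, hρ, h⟩ := exists_polynomial_near_integral_of_peak hC hr hpc hp
      exact ⟨ball c ρ, mem_nhdsWithin_of_mem_nhds (ball_mem_nhds c hρ), ball c ρ, subset_rfl,
        measurableSet_ball, fun B hB hBm _ => h B hB hBm⟩)
  exact hQ _ (ball_subset_closedBall.trans hS) measurableSet_ball isBounded_ball

theorem star_coordMap_mem [CompactSpace K] (hKc : IsConnected Kᶜ) (hKi : interior K = ∅) :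
    star (coordMap K) ∈ polyClosure K := by
  obtain ⟨C, hC, h⟩ := exists_polynomial_near_integral hKc hKi
  set R := ‖coordMap K‖ + 1 with hR
  set J := ∫ w in ball (0 : ℂ) (2 * R), weakKernel w with hJ
  have hJ0 : 0 ≤ J := setIntegral_nonneg measurableSet_ball fun w _ => weakKernel_nonneg w
  refine Metric.mem_closure_iff.2 fun ε hε => ?_
  set η := ε / (2 * C * (J + 1)) with hη
  have hη0 : 0 < η := by positivity
  -- With `r = η ^ 2 / 2` the factor `√(2 * r)` is `η`, and `2 * C * η * (J + 1) = ε`.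
  obtain ⟨Q, hQ⟩ := h (η ^ 2 / 2) (by positivity) R
  refine ⟨(Polynomial.C (Real.pi : ℂ)⁻¹ * Q).toContinuousMapOn K, ⟨_, by simp, rfl⟩, ?_⟩
  rw [ContinuousMap.dist_lt_iff hε]
  intro z
  have hz : ‖(z : ℂ)‖ < R := ((coordMap K).norm_coe_le_norm z).trans_lt (lt_add_one _)
  have h1 := hQ z z.2
  rw [integral_ball_inv_sub hz, mul_div_cancel₀ _ two_ne_zero, Real.sqrt_sq hη0.le] at h1
  have h2 : 2 * C * η * ∫ ζ in ball (0 : ℂ) R, weakKernel (z - ζ) < ε := by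
    have h3 : 2 * C * η * (J + 1) = ε := by rw [hη]; field_simp
    rw [← h3]
    exact mul_lt_mul_of_pos_left ((setIntegral_weakKernel_le hz).trans_lt (lt_add_one J))
      (by positivity)
  have hpi : (Real.pi : ℂ) ≠ 0 := by exact_mod_cast Real.pi_ne_zero
  have h4 : star (coordMap K) z - (Polynomial.C (Real.pi : ℂ)⁻¹ * Q).toContinuousMapOn K z =
      (Real.pi : ℂ)⁻¹ * (Real.pi * (starRingEnd ℂ) z - Q.eval (z : ℂ)) := by
    rw [mul_sub, inv_mul_cancel_left₀ hpi]
    simp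
  rw [dist_eq_norm, h4, norm_mul, norm_inv, Complex.norm_real, Real.norm_of_nonneg Real.pi_pos.le]
  refine lt_of_le_of_lt (mul_le_of_le_one_left (norm_nonneg _) ?_) (h1.trans_lt h2)
  exact inv_le_one_of_one_le₀ (by linarith [Real.pi_gt_three])

/-- **Lavrentiev's theorem**. -/
theorem polyClosure_eq_top [CompactSpace K] (hKc : IsConnected Kᶜ) (hKi : interior K = ∅) :
    polyClosure K = ⊤ := by
  have h1 := polynomialFunctions.starClosure_topologicalClosure K
  have h2 : (polynomialFunctions K).starClosure.toSubalgebra ≤ polyClosure K := by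
    rw [polynomialFunctions.starClosure_eq_adjoin_X, StarAlgebra.adjoin_toSubalgebra,
      Algebra.adjoin_le_iff]
    have hX : Polynomial.toContinuousMapOnAlgHom K Polynomial.X = coordMap K := by ext; simp
    rintro u (hu | hu)
    · rw [Set.mem_singleton_iff.1 hu, hX]
      exact coordMap_mem
    · rw [← star_star u, Set.mem_singleton_iff.1 (Set.mem_star.1 hu), hX]
      exact star_coordMap_mem hKc hKi
  refine top_unique fun u _ => ?_
  have h3 : u ∈ (polynomialFunctions K).starClosure.topologicalClosure := by rw [h1]; trivial
  exact closure_minimal h2 isClosed_polyClosure h3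

/-! ### Removing zeros from `K` -/

theorem Polynomial.exists_near_of_nonvanishing {K : Set ℂ} (hK : IsCompact K)
    (hKi : interior K = ∅) (p : Polynomial ℂ) {ε : ℝ} (hε : 0 < ε) :
    ∃ q : Polynomial ℂ, (∀ z ∈ K, q.eval z ≠ 0) ∧ ∀ z ∈ K, ‖q.eval z - p.eval z‖ < ε := by
  have : CompactSpace K := isCompact_iff_compactSpace.1 hK
  let φ : Polynomial ℂ →* C(K, ℂ) := (Polynomial.toContinuousMapOnAlgHom K : Polynomial ℂ →* C(K, ℂ))
  have hφ : ∀ (q : Polynomial ℂ) (z : K), φ q z = q.eval (z : ℂ) := fun q z => rfl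
  let M : Submonoid (Polynomial ℂ) :=
    { carrier := {q | ∀ z ∈ K, q.eval z ≠ 0}
      one_mem' := fun z _ => by simp
      mul_mem' := fun {a b} ha hb z hz => by simp [ha z hz, hb z hz] }
  -- The closure of a submonoid of `C(K, ℂ)` is again a submonoid, so approximability by zero-free
  -- polynomials need only be checked on linear factors and constants. The constant `0` covers `p =
  -- 0`.
  let T : Submonoid (Polynomial ℂ) := (M.map φ).topologicalClosure.comap φ
  have hT : ∀ q : Polynomial ℂ, q ∈ T ↔ ∀ ε > 0, ∃ q' ∈ M, dist (φ q) (φ q') < ε := fun q => by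
    change φ q ∈ closure (φ '' M) ↔ _
    simp [Metric.mem_closure_iff]
  have hX : ∀ a, Polynomial.X - Polynomial.C a ∈ T := fun a => (hT _).2 fun ε hε => by
    have h1 : a ∈ closure Kᶜ := by rw [closure_compl, hKi, Set.compl_empty]; trivial
    obtain ⟨b, hb, hab⟩ := Metric.mem_closure_iff.1 h1 ε hε
    refine ⟨Polynomial.X - Polynomial.C b, fun z hz h => hb ?_, ?_⟩
    · rw [Polynomial.eval_sub, Polynomial.eval_X, Polynomial.eval_C, sub_eq_zero] at h
      exact h ▸ hz
    · rw [ContinuousMap.dist_lt_iff hε]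
      intro z
      rw [hφ, hφ, Polynomial.eval_sub, Polynomial.eval_sub, Polynomial.eval_X, Polynomial.eval_C,
        Polynomial.eval_C, dist_sub_left]
      exact hab
  have hC : ∀ a, Polynomial.C a ∈ T := fun a => (hT _).2 fun ε hε => by
    have h1 : a ∈ closure ({0}ᶜ : Set ℂ) := (dense_compl_singleton (0 : ℂ)) a
    obtain ⟨b, hb, hab⟩ := Metric.mem_closure_iff.1 h1 ε hε
    refine ⟨Polynomial.C b, fun z _ => by simpa using hb, ?_⟩
    rw [ContinuousMap.dist_lt_iff hε]
    intro z
    simpa [hφ] using hab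
  have hp : p ∈ T := by
    rw [(IsAlgClosed.splits p).eq_prod_roots]
    refine T.mul_mem (hC _) (T.multiset_prod_mem _ fun q hq => ?_)
    obtain ⟨a, -, rfl⟩ := Multiset.mem_map.1 hq
    exact hX a
  obtain ⟨q, hq, hpq⟩ := (hT p).1 hp ε hε
  refine ⟨q, hq, fun z hz => ?_⟩
  rw [← dist_eq_norm, dist_comm]
  exact (ContinuousMap.dist_apply_le_dist (f := φ p) (g := φ q) ⟨z, hz⟩).trans_lt hpq

end

theorem theorem1 (K : Set ℂ) (hK : IsCompact K) (hKc : IsConnected Kᶜ)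
    (hKi : interior K = ∅) (f : ℂ → ℂ) (hf : ContinuousOn f K) (ε : ℝ) (hε : 0 < ε) :
    ∃ p : Polynomial ℂ, (∀ z ∈ K, p.eval z ≠ 0) ∧ ∀ z ∈ K, ‖p.eval z - f z‖ < ε := by
  have : CompactSpace K := isCompact_iff_compactSpace.1 hK
  have hmem : (⟨_, hf.domRestrict⟩ : C(K, ℂ)) ∈ polyClosure K := by
    rw [polyClosure_eq_top hKc hKi]; trivial
  obtain ⟨p, hp⟩ := exists_polynomial_of_mem_polyClosure hmem (half_pos hε)
  obtain ⟨q, hq0, hq⟩ := Polynomial.exists_near_of_nonvanishing hK hKi p (half_pos hε)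
  refine ⟨q, hq0, fun z hz => ?_⟩
  have h1 := hp ⟨z, hz⟩
  have h2 := norm_add_le (q.eval z - p.eval z) (p.eval z - f z)
  rw [sub_add_sub_cancel] at h2
  simp only [ContinuousMap.coe_mk, Set.domRestrict_apply] at h1
  linarith [hq z hz]
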